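/- Let $\gamma>0$, let $r_1$ be the unique solution in $[0,1]$ of $x+x^{1+\gamma}=1$, and let $f\colon[0,1]\to[0,1]$ be the Manneville--Pomeau map $$f(x)=\begin{cases}x+x^{1+\gamma}&\text{if }0\le x<r_1,\\ x+x^{1+\gamma}-1&\text{if }r_1\le x\le 1.\end{cases}$$ Then the set $$\mathcal E_f=\big\{x\in[0,1]\colon [0,\epsilon)\cap\{f^n x\}_{n\ge 0}=\emptyset\text{ for some }\epsilon>0\big\}$$ is strong winning for Schmidt's game on $[0,1]$; that is, there is $\alpha\in(0,1)$ (depending on $\gamma$) such that for every $\beta\in(0,1)$ Alice has a winning strategy in the following game. Alice and Bob alternately choose nondegenerate closed intervals $B_1\supseteq A_1\supseteq B_2\supseteq A_2\supseteq\cdots$ in $[0,1]$, Bob choosing the $B_n$ (with $B_1$ arbitrary) and Alice the $A_n$, subject to $|A_n|\ge\alpha|B_n|$ and $|B_{n+1}|\ge\beta|A_n|$ for all $n\geq 1$; Alice wins if and only if $\bigcap_n A_n$ meets $\mathcal E_f$. -/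

import Mathlib

namespace SchmidtGame

/-- A nondegenerate closed interval `[left, right]` contained in `[0,1]`. -/
structure ClosedInterval where
  left : ℝ
  right : ℝ
  zero_le_left : 0 ≤ left
  left_lt_right : left < right
  right_le_one : right ≤ 1

/-- The interval as a set of real numbers. -/
def ClosedInterval.toSet (I : ClosedInterval) : Set ℝ := Set.Icc I.left I.right

/-- The length `|I|` of an interval. -/
def ClosedInterval.length (I : ClosedInterval) : ℝ := I.right - I.left

/-- A strategy for Alice: given the first `n + 1` intervals chosen by Bob, it names
Alice's reply. -/
def Strategy : Type := (n : ℕ) → (Fin (n + 1) → ClosedInterval) → ClosedInterval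

/-- The intervals that Alice plays when she follows `σ` against Bob's moves `B 0, B 1, …`.
Rounds are numbered from `0`. -/
def Strategy.play (σ : Strategy) (B : ℕ → ClosedInterval) (n : ℕ) : ClosedInterval :=
  σ n (fun i => B i)

/-- In the strong game, Alice's reply `A` to Bob's interval `B` is legal if `A ⊆ B` and
`|A| ≥ α |B|`. -/
def LegalAlice (α : ℝ) (B A : ClosedInterval) : Prop :=
  A.toSet ⊆ B.toSet ∧ α * B.length ≤ A.length

/-- In the strong game, Bob's reply `B` to Alice's interval `A` is legal if `B ⊆ A` and
`|B| ≥ β |A|`. -/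
def LegalBob (β : ℝ) (A B : ClosedInterval) : Prop :=
  B.toSet ⊆ A.toSet ∧ β * A.length ≤ B.length

/-- `σ` is a winning strategy for Alice in the strong `(α, β)`-game with target set `S`:
as long as Bob has played legally, Alice's replies are legal, and in every infinite play in which
Bob plays legally the intersection of the chosen intervals meets `S`. Bob's first interval is
arbitrary. -/
def Strategy.IsWinning (σ : Strategy) (α β : ℝ) (S : Set ℝ) : Prop :=
  ∀ B : ℕ → ClosedInterval,
    (∀ n, (∀ k < n, LegalBob β (σ.play B k) (B (k + 1))) → LegalAlice α (B n) (σ.play B n)) ∧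
    ((∀ n, LegalBob β (σ.play B n) (B (n + 1))) →
      ((⋂ n, (σ.play B n).toSet) ∩ S).Nonempty)

/-- `S` is `(α, β)`-strong winning. -/
def IsStrongWinningPair (α β : ℝ) (S : Set ℝ) : Prop :=
  ∃ σ : Strategy, σ.IsWinning α β S

/-- `S` is `α`-strong winning: `(α, β)`-strong winning for every `β ∈ (0,1)`. -/
def IsAlphaStrongWinning (α : ℝ) (S : Set ℝ) : Prop :=
  ∀ β ∈ Set.Ioo (0 : ℝ) 1, IsStrongWinningPair α β S

/-- `S` is strong winning: `α`-strong winning for some `α ∈ (0,1)`. -/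
def IsStrongWinning (S : Set ℝ) : Prop :=
  ∃ α ∈ Set.Ioo (0 : ℝ) 1, IsAlphaStrongWinning α S

end SchmidtGame

namespace MannevillePomeau

/-- For `γ > 0` the equation `x + x ^ (1 + γ) = 1` has exactly one solution in `[0,1]`. -/
theorem existsUnique_branchPoint {γ : ℝ} (hγ : 0 < γ) :
    ∃! r : ℝ, r ∈ Set.Icc (0 : ℝ) 1 ∧ r + r ^ (1 + γ) = 1 := by
  have hc : Continuous fun x : ℝ => x + x ^ (1 + γ) :=
    continuous_id.add (Real.continuous_rpow_const (by linarith))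
  have h0 : (0 : ℝ) ^ (1 + γ) = 0 := Real.zero_rpow (by linarith)
  have hivt := intermediate_value_Icc (zero_le_one' ℝ) hc.continuousOn
  obtain ⟨r, hr, hr1⟩ := hivt (show (1 : ℝ) ∈ _ by simp [h0])
  refine ⟨r, ⟨hr, hr1⟩, ?_⟩
  rintro s ⟨hs, hs1⟩
  have hr1' : r + r ^ (1 + γ) = 1 := hr1
  rcases lt_trichotomy s r with h | h | h
  · have := Real.rpow_lt_rpow hs.1 h (show 0 < 1 + γ by linarith)
    linarith
  · exact h
  · have := Real.rpow_lt_rpow hr.1 h (show 0 < 1 + γ by linarith)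
    linarith

/-- The branch point `r₁`: the unique solution of `x + x ^ (1 + γ) = 1` in `[0,1]`. -/
noncomputable def branchPoint (γ : ℝ) (hγ : 0 < γ) : ℝ :=
  (existsUnique_branchPoint hγ).choose

theorem branchPoint_spec (γ : ℝ) (hγ : 0 < γ) :
    branchPoint γ hγ ∈ Set.Icc (0 : ℝ) 1 ∧
      branchPoint γ hγ + branchPoint γ hγ ^ (1 + γ) = 1 :=
  (existsUnique_branchPoint hγ).choose_spec.1

/-- The Manneville–Pomeau map with parameter `γ`. Only its values on `[0,1]` matter. -/
noncomputable def map (γ : ℝ) (hγ : 0 < γ) (x : ℝ) : ℝ :=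
  if x < branchPoint γ hγ then x + x ^ (1 + γ) else x + x ^ (1 + γ) - 1

/-- The map sends `[0,1]` into itself. -/
theorem mapsTo_map (γ : ℝ) (hγ : 0 < γ) :
    Set.MapsTo (map γ hγ) (Set.Icc 0 1) (Set.Icc 0 1) := by
  rintro x ⟨hx0, hx1⟩
  obtain ⟨⟨hr0, _⟩, hr⟩ := branchPoint_spec γ hγ
  have hp : 0 < 1 + γ := by linarith
  have hx : 0 ≤ x ^ (1 + γ) := Real.rpow_nonneg hx0 _
  unfold map
  split_ifs with h
  · have := Real.rpow_lt_rpow hx0 h hp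
    constructor <;> linarith
  · have h1 := Real.rpow_le_rpow hr0 (not_lt.mp h) hp.le
    have h2 := Real.rpow_le_one hx0 hx1 hp.le
    constructor <;> linarith [not_lt.mp h]

/-- The set of points of `[0,1]` whose forward orbit (the point itself included) misses `[0, ε)`
for some `ε > 0`. -/
def exceptionalSet (γ : ℝ) (hγ : 0 < γ) : Set ℝ :=
  {x | x ∈ Set.Icc (0 : ℝ) 1 ∧
    ∃ ε : ℝ, 0 < ε ∧ Set.Ico 0 ε ∩ Set.range (fun n : ℕ => (map γ hγ)^[n] x) = ∅}

end MannevillePomeau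

/-! On `[0, r₁)` the map only moves points up, so an orbit starting at or above `t` can enter `[0,
t)` only through the right branch, from just right of `r₁`. It therefore suffices to avoid `[0, t)`
and, for every word `w` of inverse branches, the hole `φ_w [r₁, s]`, where `φ_w = wordMap w` and the
right branch sends `s` to `t` (`mem_exceptionalSet`).

The neutral fixed point at `0` spoils uniform expansion, so distortion is controlled by two
properties that survive composition: every `φ_w` is concave, and it becomes convex after conjugation
by `x ↦ -x ^ (-γ)`. The first compares the hole with the part of the cylinder `φ_w [0, 1]` on its
left, the second with the part on its right. Both parts exceed the hole by a factor of order `1 / t`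
(`exists_hole_le`). The left end of another hole whose word is no longer than `w` is never interior
to the cylinder of `w`, so two distinct holes lie much farther apart than the length of the smaller
one (`exists_hole_separation`).

In the game, take `t` to be a small multiple of the length of Bob's first interval. At each turn at
most one hole of length comparable to Bob's interval `B` matters, and it is too short to meet both
outer quarters of `B`. Alice plays a quarter that misses it, and every hole is dealt with at some
turn. -/

namespace MannevillePomeau

open Set

/-! ### A global inverse for both branches -/

/-- A strictly increasing extension to `ℝ` of `x ↦ x + x ^ (1 + γ)`. -/
noncomputable def lift (γ x : ℝ) : ℝ := x + (max x 0) ^ (1 + γ)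

theorem lift_of_nonneg {γ x : ℝ} (hx : 0 ≤ x) : lift γ x = x + x ^ (1 + γ) := by
  rw [lift, max_eq_left hx]

theorem strictMono_lift {γ : ℝ} (hγ : 0 < γ) : StrictMono (lift γ) := by
  intro x y h
  have h1 : (max x 0) ^ (1 + γ) ≤ (max y 0) ^ (1 + γ) :=
    Real.rpow_le_rpow (le_max_right _ _) (max_le_max_right _ h.le) (by linarith)
  unfold lift
  linarith

theorem continuous_lift {γ : ℝ} (hγ : 0 < γ) : Continuous (lift γ) := by
  have : Continuous fun x : ℝ => (max x 0) ^ (1 + γ) :=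
    (continuous_id.max continuous_const).rpow_const fun _ => Or.inr (by linarith)
  exact continuous_id.add this

theorem surjective_lift {γ : ℝ} (hγ : 0 < γ) : Function.Surjective (lift γ) := by
  refine (continuous_lift hγ).surjective ?_ ?_
  · refine Filter.tendsto_atTop_mono (fun x => ?_) Filter.tendsto_id
    have := Real.rpow_nonneg (le_max_right x 0) (1 + γ)
    simp only [lift, id]
    linarith
  · refine Filter.Tendsto.congr' ?_ Filter.tendsto_id
    filter_upwards [Filter.eventually_le_atBot (0 : ℝ)] with x hx
    rw [lift, max_eq_right hx, Real.zero_rpow (by linarith)]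
    simp

/-- The order isomorphism of `ℝ` inverse to `lift γ`. -/
noncomputable def liftInv (γ : ℝ) (hγ : 0 < γ) : ℝ ≃o ℝ :=
  ((strictMono_lift hγ).orderIsoOfSurjective _ (surjective_lift hγ)).symm

section

variable {γ : ℝ} (hγ : 0 < γ)

theorem lift_liftInv (x : ℝ) : lift γ (liftInv γ hγ x) = x :=
  ((strictMono_lift hγ).orderIsoOfSurjective _ (surjective_lift hγ)).apply_symm_apply x

theorem liftInv_lift (x : ℝ) : liftInv γ hγ (lift γ x) = x :=
  ((strictMono_lift hγ).orderIsoOfSurjective _ (surjective_lift hγ)).symm_apply_apply x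

theorem liftInv_zero : liftInv γ hγ 0 = 0 := by
  have : lift γ 0 = 0 := by
    rw [lift_of_nonneg le_rfl, Real.zero_rpow (by linarith), add_zero]
  conv_lhs => rw [← this]
  exact liftInv_lift hγ 0

theorem liftInv_one : liftInv γ hγ 1 = branchPoint γ hγ := by
  obtain ⟨h, h'⟩ := branchPoint_spec γ hγ
  rw [← h', ← lift_of_nonneg h.1, liftInv_lift]

theorem liftInv_two : liftInv γ hγ 2 = 1 := by
  have : lift γ 1 = 2 := by
    rw [lift_of_nonneg zero_le_one, Real.one_rpow]; norm_num
  rw [← this, liftInv_lift]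

theorem liftInv_pos {x : ℝ} (hx : 0 < x) : 0 < liftInv γ hγ x := by
  simpa [liftInv_zero] using (liftInv γ hγ).strictMono hx

theorem liftInv_nonneg {x : ℝ} (hx : 0 ≤ x) : 0 ≤ liftInv γ hγ x := by
  simpa [liftInv_zero] using (liftInv γ hγ).monotone hx

theorem hasDerivAt_liftInv {x : ℝ} (hx : 0 < x) :
    HasDerivAt (liftInv γ hγ) (1 + (1 + γ) * liftInv γ hγ x ^ γ)⁻¹ x := by
  have hy := liftInv_pos hγ hx
  have h1 : HasDerivAt (lift γ) (1 + (1 + γ) * liftInv γ hγ x ^ γ) (liftInv γ hγ x) := by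
    have h := (hasDerivAt_id (liftInv γ hγ x)).add
      (Real.hasDerivAt_rpow_const (p := 1 + γ) (Or.inl hy.ne'))
    rw [add_sub_cancel_left] at h
    refine h.congr_of_eventuallyEq ?_
    filter_upwards [eventually_gt_nhds hy] with z hz
    simp [lift_of_nonneg hz.le]
  refine HasDerivAt.of_local_left_inverse (liftInv γ hγ).continuous.continuousAt h1 ?_ ?_
  · have := Real.rpow_nonneg hy.le γ
    positivity
  · exact Filter.Eventually.of_forall (lift_liftInv hγ)

end

/-- The convexity condition of `IsContractingBranch` for an inverse branch `φ`, cleared of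
denominators: `a = φ x` and `b = φ y` with `x = a + a ^ (1 + γ) - e`, and `φ' x` is the inverse of
`1 + (1 + γ) * a ^ γ`. The case `e = 0` reduces to Bernoulli's inequality in `a ^ γ`; a positive
shift `e` only helps. -/
theorem one_add_mul_div_rpow_antitone {γ a b : ℝ} (hγ : 0 < γ) (e : ℝ) (he : 0 ≤ e)
    (ha : 0 < a) (hab : a ≤ b) (hea : 0 < a + a ^ (1 + γ) - e) :
    (1 + (1 + γ) * b ^ γ) * (a + a ^ (1 + γ) - e) ^ (1 + γ) * b ^ (1 + γ) ≤
      (1 + (1 + γ) * a ^ γ) * (b + b ^ (1 + γ) - e) ^ (1 + γ) * a ^ (1 + γ) := by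
  have hb : 0 < b := ha.trans_le hab
  have hp : 0 < 1 + γ := by linarith
  have hs : 0 < a ^ γ := Real.rpow_pos_of_pos ha _
  have hst : a ^ γ ≤ b ^ γ := Real.rpow_le_rpow ha.le hab hγ.le
  have ha' : a ^ (1 + γ) = a * a ^ γ := by rw [Real.rpow_add ha, Real.rpow_one]
  have hb' : b ^ (1 + γ) = b * b ^ γ := by rw [Real.rpow_add hb, Real.rpow_one]
  set s := a ^ γ with hsdef
  set t := b ^ γ with htdef
  -- Bernoulli applied to `(1 + t) / (1 + s) = 1 + (t - s) / (1 + s)`.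
  have key : (1 + (1 + γ) * t) * (1 + s) ^ (1 + γ) ≤ (1 + (1 + γ) * s) * (1 + t) ^ (1 + γ) := by
    have hbern := one_add_mul_self_le_rpow_one_add (s := (t - s) / (1 + s)) (p := 1 + γ)
      (by have : 0 ≤ (t - s) / (1 + s) := div_nonneg (by linarith) (by linarith)
          linarith) (by linarith)
    have h1 : 1 + (t - s) / (1 + s) = (1 + t) / (1 + s) := by field_simp; ring
    rw [h1, Real.div_rpow (by linarith) (by linarith), le_div_iff₀ (by positivity)] at hbern
    have h2 : 1 + (1 + γ) * t ≤ (1 + (1 + γ) * s) * (1 + (1 + γ) * ((t - s) / (1 + s))) := by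
      have h3 : (t - s) / (1 + s) * (1 + s) = t - s := by field_simp
      have h4 : 0 ≤ (t - s) / (1 + s) := div_nonneg (by linarith) (by linarith)
      nlinarith [mul_nonneg (mul_nonneg hp.le h4) (mul_nonneg hγ.le hs.le)]
    calc (1 + (1 + γ) * t) * (1 + s) ^ (1 + γ)
        ≤ (1 + (1 + γ) * s) * (1 + (1 + γ) * ((t - s) / (1 + s))) * (1 + s) ^ (1 + γ) :=
          mul_le_mul_of_nonneg_right h2 (by positivity)
      _ = (1 + (1 + γ) * s) * ((1 + (1 + γ) * ((t - s) / (1 + s))) * (1 + s) ^ (1 + γ)) := by ring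
      _ ≤ _ := mul_le_mul_of_nonneg_left hbern (by positivity)
  have hA : a + a ^ (1 + γ) = a * (1 + s) := by rw [ha']; ring
  have hB : b + b ^ (1 + γ) = b * (1 + t) := by rw [hb']; ring
  rw [hA] at hea ⊢
  rw [hB]
  have ht : 0 < t := hs.trans_le hst
  have hAB : a * (1 + s) ≤ b * (1 + t) := mul_le_mul hab (by linarith) (by linarith) hb.le
  -- The ratio `(z - e) / z` increases with `z`.
  have h5 : (a * (1 + s) - e) * (b * (1 + t)) ≤ (b * (1 + t) - e) * (a * (1 + s)) := by
    nlinarith [mul_le_mul_of_nonneg_left hAB he]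
  have h6 := Real.rpow_le_rpow (mul_nonneg hea.le (by positivity)) h5 hp.le
  rw [Real.mul_rpow hea.le (by positivity),
    Real.mul_rpow hb.le (by linarith), Real.mul_rpow (by linarith) (by positivity),
    Real.mul_rpow ha.le (by linarith)] at h6
  set P := (a * (1 + s) - e) ^ (1 + γ)
  set Q := (b * (1 + t) - e) ^ (1 + γ)
  have hQ : 0 ≤ Q := Real.rpow_nonneg (by linarith) _
  have hT : 0 < (1 + t) ^ (1 + γ) := Real.rpow_pos_of_pos (by linarith) _
  have ha0 : 0 ≤ a ^ (1 + γ) := Real.rpow_nonneg ha.le _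
  refine le_of_mul_le_mul_right ?_ hT
  calc (1 + (1 + γ) * t) * P * b ^ (1 + γ) * (1 + t) ^ (1 + γ)
      = (1 + (1 + γ) * t) * (P * (b ^ (1 + γ) * (1 + t) ^ (1 + γ))) := by ring
    _ ≤ (1 + (1 + γ) * t) * (Q * (a ^ (1 + γ) * (1 + s) ^ (1 + γ))) :=
        mul_le_mul_of_nonneg_left h6 (by positivity)
    _ = ((1 + (1 + γ) * t) * (1 + s) ^ (1 + γ)) * (Q * a ^ (1 + γ)) := by ring
    _ ≤ ((1 + (1 + γ) * s) * (1 + t) ^ (1 + γ)) * (Q * a ^ (1 + γ)) :=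
        mul_le_mul_of_nonneg_right key (by positivity)
    _ = _ := by ring

/-! ### Distortion of compositions of inverse branches -/

/-- Increasing self-maps of `[0,1]` which are concave, contract distances, and become convex after
conjugation by `x ↦ -x ^ (-γ)`. This class is closed under composition. -/
structure IsContractingBranch (γ : ℝ) (φ : ℝ → ℝ) : Prop where
  strictMonoOn : StrictMonoOn φ (Icc 0 1)
  continuousOn : ContinuousOn φ (Icc 0 1)
  mapsTo : MapsTo φ (Icc 0 1) (Icc 0 1)
  exists_deriv : ∃ φ' : ℝ → ℝ, (∀ x ∈ Ioo (0 : ℝ) 1, HasDerivAt φ (φ' x) x ∧ 0 < φ' x ∧ φ' x ≤ 1) ∧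
    ∀ x ∈ Ioo (0 : ℝ) 1, ∀ y ∈ Ioo (0 : ℝ) 1, x ≤ y → φ' y ≤ φ' x ∧
      φ' x * x ^ (1 + γ) * φ y ^ (1 + γ) ≤ φ' y * y ^ (1 + γ) * φ x ^ (1 + γ)

namespace IsContractingBranch

variable {γ : ℝ} {φ ψ : ℝ → ℝ}

theorem mapsTo_Ioo (h : IsContractingBranch γ φ) : MapsTo φ (Ioo 0 1) (Ioo 0 1) := by
  intro x hx
  have h0 : (0 : ℝ) ∈ Icc (0 : ℝ) 1 := ⟨le_rfl, zero_le_one⟩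
  have h1 : (1 : ℝ) ∈ Icc (0 : ℝ) 1 := ⟨zero_le_one, le_rfl⟩
  have hx' := Ioo_subset_Icc_self hx
  exact ⟨(h.mapsTo h0).1.trans_lt (h.strictMonoOn h0 hx' hx.1),
    (h.strictMonoOn hx' h1 hx.2).trans_le (h.mapsTo h1).2⟩

theorem id (γ : ℝ) : IsContractingBranch γ id where
  strictMonoOn := strictMono_id.strictMonoOn _
  continuousOn := continuousOn_id
  mapsTo := mapsTo_id _
  exists_deriv := ⟨fun _ => 1, fun x _ => ⟨hasDerivAt_id x, one_pos, le_rfl⟩,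
    fun x _ y _ _ => ⟨le_rfl, by simp only [_root_.id]; exact le_of_eq (by ring)⟩⟩

/-- By the chain rule both the derivatives and the slopes of the conjugated maps multiply; the
factors in `ψ x` and `ψ y` cancel. -/
theorem comp (hφ : IsContractingBranch γ φ) (hψ : IsContractingBranch γ ψ) :
    IsContractingBranch γ (φ ∘ ψ) where
  strictMonoOn := hφ.strictMonoOn.comp hψ.strictMonoOn hψ.mapsTo
  continuousOn := hφ.continuousOn.comp hψ.continuousOn hψ.mapsTo
  mapsTo := hφ.mapsTo.comp hψ.mapsTo
  exists_deriv := by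
    obtain ⟨φ', h1, h2⟩ := hφ.exists_deriv
    obtain ⟨ψ', k1, k2⟩ := hψ.exists_deriv
    refine ⟨fun x => φ' (ψ x) * ψ' x, fun x hx => ?_, fun x hx y hy hxy => ?_⟩
    · obtain ⟨d, p, l⟩ := h1 _ (hψ.mapsTo_Ioo hx)
      obtain ⟨d', p', l'⟩ := k1 _ hx
      exact ⟨d.comp x d', mul_pos p p', mul_le_one₀ l p'.le l'⟩
    · have hx' := hψ.mapsTo_Ioo hx
      have hy' := hψ.mapsTo_Ioo hy
      have hxy' := hψ.strictMonoOn.monotoneOn (Ioo_subset_Icc_self hx) (Ioo_subset_Icc_self hy) hxy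
      obtain ⟨a1, a2⟩ := h2 _ hx' _ hy' hxy'
      obtain ⟨b1, b2⟩ := k2 _ hx _ hy hxy
      refine ⟨mul_le_mul a1 b1 (k1 y hy).2.1.le (h1 _ hx').2.1.le, ?_⟩
      have hX : 0 < ψ x ^ (1 + γ) := Real.rpow_pos_of_pos hx'.1 _
      have hY : 0 < ψ y ^ (1 + γ) := Real.rpow_pos_of_pos hy'.1 _
      have c1 : 0 < φ (ψ x) ^ (1 + γ) := Real.rpow_pos_of_pos (hφ.mapsTo_Ioo hx').1 _
      have c2 : 0 < φ (ψ y) ^ (1 + γ) := Real.rpow_pos_of_pos (hφ.mapsTo_Ioo hy').1 _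
      have e1 : 0 < x ^ (1 + γ) := Real.rpow_pos_of_pos hx.1 _
      have := mul_le_mul a2 b2
        (mul_nonneg (mul_nonneg (k1 x hx).2.1.le e1.le) hY.le)
        (mul_nonneg (mul_nonneg (h1 _ hy').2.1.le hY.le) c1.le)
      refine le_of_mul_le_mul_right ?_ (mul_pos hX hY)
      simp only [Function.comp]
      linarith

theorem exists_slope (h : IsContractingBranch γ φ) {φ' : ℝ → ℝ}
    (h' : ∀ x ∈ Ioo (0 : ℝ) 1, HasDerivAt φ (φ' x) x) {a b : ℝ} (ha : 0 ≤ a) (hab : a < b)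
    (hb : b ≤ 1) : ∃ c ∈ Ioo a b, φ b - φ a = φ' c * (b - a) := by
  obtain ⟨c, hc, e⟩ := exists_hasDerivAt_eq_slope φ φ' hab
    (h.continuousOn.mono (Icc_subset_Icc ha hb))
    (fun x hx => h' x ⟨ha.trans_lt hx.1, hx.2.trans_le hb⟩)
  refine ⟨c, hc, ?_⟩
  rw [e]
  field_simp [(sub_pos.2 hab).ne']

theorem sub_le (h : IsContractingBranch γ φ) {a b : ℝ} (ha : 0 ≤ a) (hab : a < b) (hb : b ≤ 1) :
    φ b - φ a ≤ b - a := by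
  obtain ⟨φ', h1, -⟩ := h.exists_deriv
  obtain ⟨c, hc, e⟩ := h.exists_slope (fun x hx => (h1 x hx).1) ha hab hb
  have := (h1 c ⟨ha.trans_lt hc.1, hc.2.trans_le hb⟩).2.2
  rw [e]
  nlinarith

/-- The image of `[r, s]` is small compared with the image of `[0, r]`. -/
theorem sub_le_left (h : IsContractingBranch γ φ) {r s : ℝ} (hr : 0 < r) (hrs : r < s)
    (hs : s ≤ 1) : r * (φ s - φ r) ≤ (s - r) * (φ r - φ 0) := by
  obtain ⟨φ', h1, h2⟩ := h.exists_deriv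
  obtain ⟨c, hc, e⟩ := h.exists_slope (fun x hx => (h1 x hx).1) hr.le hrs hs
  obtain ⟨d, hd, e'⟩ := h.exists_slope (fun x hx => (h1 x hx).1) le_rfl hr (hrs.le.trans hs)
  -- Concavity: the slope over `[r, s]` is at most the slope over `[0, r]`.
  have := (h2 d ⟨hd.1, by linarith [hd.2]⟩ c ⟨by linarith [hc.1], by linarith [hc.2]⟩
    (by linarith [hd.2, hc.1])).1
  rw [e, e']
  have h3 : 0 < r * (s - r) := mul_pos hr (by linarith)
  nlinarith

/-- The image of `[r, s]` is small compared with the image of `[s, 1]`. -/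
theorem sub_le_right (hγ : 0 < γ) (h : IsContractingBranch γ φ) {r s : ℝ} (hr : 0 < r)
    (hrs : r < s) (hs : s < 1) :
    r ^ (1 + γ) * (1 - s) * (φ s - φ r) ≤ (s - r) * (φ 1 - φ s) := by
  obtain ⟨φ', h1, h2⟩ := h.exists_deriv
  obtain ⟨c, hc, e⟩ := h.exists_slope (fun x hx => (h1 x hx).1) hr.le hrs hs.le
  obtain ⟨d, hd, e'⟩ := h.exists_slope (fun x hx => (h1 x hx).1) (hr.trans hrs).le hs le_rfl
  have hc' : c ∈ Ioo (0 : ℝ) 1 := ⟨by linarith [hc.1], by linarith [hc.2]⟩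
  have hd' : d ∈ Ioo (0 : ℝ) 1 := ⟨by linarith [hd.1], hd.2⟩
  have hcd : c ≤ d := by linarith [hc.2, hd.1]
  have hp : 0 ≤ 1 + γ := by linarith
  have key := (h2 c hc' d hd' hcd).2
  have hc0 := (h1 c hc').2.1
  have hd0 := (h1 d hd').2.1
  have hφd : 0 < φ d ^ (1 + γ) := Real.rpow_pos_of_pos (h.mapsTo_Ioo hd').1 _
  have hφ : φ c ^ (1 + γ) ≤ φ d ^ (1 + γ) := Real.rpow_le_rpow (h.mapsTo_Ioo hc').1.le
    (h.strictMonoOn.monotoneOn (Ioo_subset_Icc_self hc') (Ioo_subset_Icc_self hd') hcd) hp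
  have hrc : r ^ (1 + γ) ≤ c ^ (1 + γ) := Real.rpow_le_rpow hr.le hc.1.le hp
  have hd1 : d ^ (1 + γ) ≤ 1 := Real.rpow_le_one hd'.1.le hd'.2.le hp
  -- Away from the neutral point, convexity of the conjugated map bounds how much the derivative can
  -- drop: the weights satisfy `r ≤ c` and `d ≤ 1`.
  have hbound : r ^ (1 + γ) * φ' c ≤ φ' d := by
    refine le_of_mul_le_mul_right ?_ hφd
    calc r ^ (1 + γ) * φ' c * φ d ^ (1 + γ) ≤ c ^ (1 + γ) * φ' c * φ d ^ (1 + γ) := by gcongr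
      _ = φ' c * c ^ (1 + γ) * φ d ^ (1 + γ) := by ring
      _ ≤ φ' d * d ^ (1 + γ) * φ c ^ (1 + γ) := key
      _ ≤ φ' d * 1 * φ d ^ (1 + γ) := by
          have : 0 ≤ φ c ^ (1 + γ) := Real.rpow_nonneg (h.mapsTo_Ioo hc').1.le _
          gcongr
      _ = φ' d * φ d ^ (1 + γ) := by ring
  rw [e, e']
  have h3 : 0 < (1 - s) * (s - r) := mul_pos (by linarith) (by linarith)
  nlinarith

end IsContractingBranch

/-! ### Inverse branches, words and cylinders -/

section

variable {γ : ℝ} (hγ : 0 < γ)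

/-- The two inverse branches of the Manneville–Pomeau map: `false` is the left one. -/
noncomputable def inverseBranch (e : Bool) (x : ℝ) : ℝ :=
  liftInv γ hγ (x + if e then 1 else 0)

theorem isContractingBranch_inverseBranch (e : Bool) :
    IsContractingBranch γ (inverseBranch hγ e) := by
  have he : (0 : ℝ) ≤ if e then 1 else 0 := by split_ifs <;> norm_num
  have he' : (if e then 1 else 0 : ℝ) ≤ 1 := by split_ifs <;> norm_num
  have hmono : StrictMono (inverseBranch hγ e) := fun x y h =>
    (liftInv γ hγ).strictMono (by linarith)
  refine ⟨hmono.strictMonoOn _, ?_, ?_, ?_⟩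
  · exact ((liftInv γ hγ).continuous.comp (continuous_id.add continuous_const)).continuousOn
  · intro x hx
    refine ⟨liftInv_nonneg hγ (by linarith [hx.1]), ?_⟩
    have : inverseBranch hγ e x ≤ liftInv γ hγ 2 := (liftInv γ hγ).monotone (by linarith [hx.2])
    rwa [liftInv_two] at this
  · refine ⟨fun x => (1 + (1 + γ) * inverseBranch hγ e x ^ γ)⁻¹, fun x hx => ?_,
      fun x hx y hy hxy => ?_⟩
    · have hpos : 0 < x + if e then 1 else 0 := by linarith [hx.1]
      have h0 : 0 ≤ (1 + γ) * inverseBranch hγ e x ^ γ :=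
        mul_nonneg (by linarith) (Real.rpow_nonneg (liftInv_pos hγ hpos).le _)
      refine ⟨(hasDerivAt_liftInv hγ hpos).comp_add_const x _, by positivity, ?_⟩
      exact inv_le_one_of_one_le₀ (by linarith)
    · have hx0 : 0 < inverseBranch hγ e x := liftInv_pos hγ (by linarith [hx.1])
      have hle : inverseBranch hγ e x ≤ inverseBranch hγ e y := hmono.monotone hxy
      have hx1 : 0 < (1 + (1 + γ) * inverseBranch hγ e x ^ γ) := by positivity
      have hy0 := hx0.trans_le hle
      have hy1 : 0 < (1 + (1 + γ) * inverseBranch hγ e y ^ γ) := by positivity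
      constructor
      · exact inv_anti₀ hx1 (by gcongr)
      · have ex : inverseBranch hγ e x + inverseBranch hγ e x ^ (1 + γ) -
            (if e then 1 else 0) = x := by
          rw [← lift_of_nonneg hx0.le, inverseBranch, lift_liftInv, add_sub_cancel_right]
        have ey : inverseBranch hγ e y + inverseBranch hγ e y ^ (1 + γ) -
            (if e then 1 else 0) = y := by
          rw [← lift_of_nonneg hy0.le, inverseBranch, lift_liftInv, add_sub_cancel_right]
        have key := one_add_mul_div_rpow_antitone hγ _ he hx0 hle (by rw [ex]; exact hx.1)
        rw [ex, ey] at key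
        rw [mul_assoc, mul_assoc, inv_mul_le_iff₀ hx1, ← mul_assoc, mul_comm (_ + _) (_⁻¹),
          mul_assoc, le_inv_mul_iff₀ hy1]
        linarith

/-- The inverse branch of an iterate of the map with the given itinerary. -/
noncomputable def wordMap (w : List Bool) : ℝ → ℝ :=
  fun x => w.foldr (inverseBranch hγ) x

theorem isContractingBranch_wordMap (w : List Bool) : IsContractingBranch γ (wordMap hγ w) := by
  induction w with
  | nil => exact IsContractingBranch.id γ
  | cons e w ih => exact (isContractingBranch_inverseBranch hγ e).comp ih

theorem branchPoint_mem_Ioo : branchPoint γ hγ ∈ Ioo (0 : ℝ) 1 := by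
  rw [← liftInv_one]
  exact ⟨liftInv_pos hγ one_pos,
    (liftInv_two hγ).subst ((liftInv γ hγ).strictMono (by norm_num : (1 : ℝ) < 2))⟩

theorem inverseBranch_false_lt {x : ℝ} (hx : x < 1) :
    inverseBranch hγ false x < branchPoint γ hγ := by
  rw [← liftInv_one, inverseBranch]
  exact (liftInv γ hγ).strictMono (by simpa using hx)

theorem lt_inverseBranch_true {x : ℝ} (hx : 0 < x) :
    branchPoint γ hγ < inverseBranch hγ true x := by
  rw [← liftInv_one, inverseBranch]
  exact (liftInv γ hγ).strictMono (by simpa using hx)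

theorem inverseBranch_injective (e : Bool) : Function.Injective (inverseBranch hγ e) :=
  fun _ _ h => add_right_cancel ((liftInv γ hγ).injective h)

/-- The preimage of the branch point under a word does not lie in the interior of the cylinder of a
different word which is at least as long. -/
theorem wordMap_branchPoint_ne {w : List Bool} : ∀ {v : List Bool}, v.length ≤ w.length → v ≠ w →
    ∀ x ∈ Ioo (0 : ℝ) 1, wordMap hγ v (branchPoint γ hγ) ≠ wordMap hγ w x := by
  induction w with
  | nil =>
    intro v hv hne
    exact absurd (List.eq_nil_of_length_eq_zero (Nat.le_zero.1 hv)) hne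
  | cons e w ih =>
    intro v hv hne x hx
    have hx' := (isContractingBranch_wordMap hγ w).mapsTo_Ioo hx
    cases v with
    | nil =>
      change branchPoint γ hγ ≠ inverseBranch hγ e (wordMap hγ w x)
      cases e
      · exact (inverseBranch_false_lt hγ hx'.2).ne'
      · exact (lt_inverseBranch_true hγ hx'.1).ne
    | cons d v =>
      change inverseBranch hγ d (wordMap hγ v (branchPoint γ hγ)) ≠
        inverseBranch hγ e (wordMap hγ w x)
      have hb' := (isContractingBranch_wordMap hγ v).mapsTo_Ioo (branchPoint_mem_Ioo hγ)
      by_cases hde : d = e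
      · subst hde
        exact fun h => ih (by simpa using hv) (by simpa using hne) x hx
          (inverseBranch_injective hγ d h)
      · cases d <;> cases e
        · exact absurd rfl hde
        · exact ((inverseBranch_false_lt hγ hb'.2).trans (lt_inverseBranch_true hγ hx'.1)).ne
        · exact ((inverseBranch_false_lt hγ hx'.2).trans (lt_inverseBranch_true hγ hb'.1)).ne'
        · exact absurd rfl hde

/-! ### Holes: size, separation and the exceptional set -/

/-- The left endpoint of the hole of the word `w`. -/
noncomputable def holeLeft (w : List Bool) : ℝ := wordMap hγ w (liftInv γ hγ 1)

/-- The right endpoint of the hole of the word `w`: points of the hole visit `[0, t]` right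
after following `w` and then the right branch. -/
noncomputable def holeRight (t : ℝ) (w : List Bool) : ℝ := wordMap hγ w (liftInv γ hγ (1 + t))

theorem liftInv_mem_Icc {x : ℝ} (h0 : 0 ≤ x) (h2 : x ≤ 2) : liftInv γ hγ x ∈ Icc (0 : ℝ) 1 :=
  ⟨liftInv_nonneg hγ h0, (liftInv_two hγ).subst ((liftInv γ hγ).monotone h2)⟩

theorem holeLeft_lt_holeRight {t : ℝ} (ht : 0 < t) (ht1 : t ≤ 1) (w : List Bool) :
    holeLeft hγ w < holeRight hγ t w :=
  (isContractingBranch_wordMap hγ w).strictMonoOn (liftInv_mem_Icc hγ zero_le_one one_le_two)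
    (liftInv_mem_Icc hγ (by linarith) (by linarith)) ((liftInv γ hγ).strictMono (by linarith))

theorem liftInv_sub_le {t : ℝ} (ht : 0 < t) (ht1 : t ≤ 1) :
    liftInv γ hγ (1 + t) - liftInv γ hγ 1 ≤ t := by
  have := (isContractingBranch_inverseBranch hγ true).sub_le le_rfl ht ht1
  simpa [inverseBranch, add_comm] using this

theorem holeRight_sub_holeLeft_le {t : ℝ} (ht : 0 < t) (ht1 : t ≤ 1) (w : List Bool) :
    holeRight hγ t w - holeLeft hγ w ≤ t :=
  ((isContractingBranch_wordMap hγ w).sub_le (liftInv_nonneg hγ zero_le_one)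
    ((liftInv γ hγ).strictMono (by linarith))
    (liftInv_mem_Icc hγ (by linarith) (by linarith)).2).trans (liftInv_sub_le hγ ht ht1)

/-- Holes are small compared with both parts of their cylinder. -/
theorem exists_hole_le : ∃ C : ℝ, 0 < C ∧ ∀ t : ℝ, 0 < t → t ≤ 1 / 2 → ∀ w : List Bool,
    holeRight hγ t w - holeLeft hγ w ≤ C * t * (holeLeft hγ w - wordMap hγ w 0) ∧
    holeRight hγ t w - holeLeft hγ w ≤ C * t * (wordMap hγ w 1 - holeLeft hγ w) := by
  set r := liftInv γ hγ 1 with hrdef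
  -- Since `t ≤ 1 / 2`, this bounds the right end of the unscaled hole away from `1`, uniformly in
  -- `t`.
  set u := liftInv γ hγ (3 / 2) with hudef
  have hr : 0 < r := liftInv_pos hγ one_pos
  have hu : u < 1 := by
    rw [← liftInv_two hγ]
    exact (liftInv γ hγ).strictMono (by norm_num)
  have hrp : 0 < r ^ (1 + γ) := Real.rpow_pos_of_pos hr _
  have hK : 0 < r ^ (1 + γ) * (1 - u) := mul_pos hrp (by linarith)
  refine ⟨max r⁻¹ (r ^ (1 + γ) * (1 - u))⁻¹, lt_max_of_lt_left (inv_pos.2 hr), ?_⟩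
  intro t ht ht2 w
  have hφ := isContractingBranch_wordMap hγ w
  set s := liftInv γ hγ (1 + t) with hsdef
  have hrs : r < s := (liftInv γ hγ).strictMono (by linarith)
  have hsu : s ≤ u := (liftInv γ hγ).monotone (by linarith)
  have hsr : s - r ≤ t := liftInv_sub_le hγ ht (by linarith)
  have h1 := hφ.sub_le_left hr hrs (by linarith)
  have h2 := hφ.sub_le_right hγ hr hrs (by linarith)
  have m : ∀ a b : ℝ, 0 ≤ a → a < b → b ≤ 1 → wordMap hγ w a < wordMap hγ w b :=
    fun a b ha hab hb => hφ.strictMonoOn ⟨ha, hab.le.trans hb⟩ ⟨ha.trans hab.le, hb⟩ hab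
  have m1 := m 0 r le_rfl hr (by linarith)
  have m2 := m r s hr.le hrs (by linarith)
  have m3 := m s 1 (by linarith) (by linarith) le_rfl
  change wordMap hγ w s - wordMap hγ w r ≤ _ * (wordMap hγ w r - _) ∧
    wordMap hγ w s - wordMap hγ w r ≤ _ * (_ - wordMap hγ w r)
  constructor
  · have h3 : r * (wordMap hγ w s - wordMap hγ w r) ≤
        t * (wordMap hγ w r - wordMap hγ w 0) :=
      h1.trans (mul_le_mul_of_nonneg_right hsr (by linarith))
    rw [mul_comm, ← le_div_iff₀ hr] at h3
    refine h3.trans ?_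
    rw [div_eq_inv_mul, ← mul_assoc]
    have := le_max_left r⁻¹ (r ^ (1 + γ) * (1 - u))⁻¹
    exact mul_le_mul_of_nonneg_right (mul_le_mul_of_nonneg_right this ht.le) (by linarith)
  · have h3 : r ^ (1 + γ) * (1 - u) * (wordMap hγ w s - wordMap hγ w r) ≤
        t * (wordMap hγ w 1 - wordMap hγ w r) := by
      calc _ ≤ r ^ (1 + γ) * (1 - s) * (wordMap hγ w s - wordMap hγ w r) := by
            have : 0 ≤ wordMap hγ w s - wordMap hγ w r := by linarith
            gcongr
        _ ≤ _ := h2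
        _ ≤ _ := mul_le_mul hsr (by linarith) (by linarith) ht.le
    rw [mul_comm, ← le_div_iff₀ hK] at h3
    refine h3.trans ?_
    rw [div_eq_inv_mul, ← mul_assoc]
    have := le_max_right r⁻¹ (r ^ (1 + γ) * (1 - u))⁻¹
    exact mul_le_mul_of_nonneg_right (mul_le_mul_of_nonneg_right this ht.le) (by linarith)

/-- The left endpoint of a hole does not lie in the interior of the cylinder of a different word
which is at least as long. -/
theorem wordMap_le_or_le {v w : List Bool} (hl : v.length ≤ w.length) (hne : v ≠ w) :
    holeLeft hγ v ≤ wordMap hγ w 0 ∨ wordMap hγ w 1 ≤ holeLeft hγ v := by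
  by_contra! h
  obtain ⟨x, hx, hxe⟩ := intermediate_value_Ioo zero_le_one
    (isContractingBranch_wordMap hγ w).continuousOn h
  refine wordMap_branchPoint_ne hγ hl hne x hx ?_
  rw [hxe, holeLeft, liftInv_one]

/-- Distinct holes of comparable size are far apart. -/
theorem exists_hole_separation : ∃ C : ℝ, 0 < C ∧ ∀ t : ℝ, 0 < t → t ≤ 1 / 2 →
    ∀ v w : List Bool, v ≠ w →
    min (holeRight hγ t v - holeLeft hγ v) (holeRight hγ t w - holeLeft hγ w) ≤
      C * t * |holeLeft hγ v - holeLeft hγ w| := by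
  obtain ⟨C, hC, h⟩ := exists_hole_le hγ
  refine ⟨C, hC, fun t ht ht2 => ?_⟩
  -- The hole of the longer word is the one controlled: the other left endpoint lies outside the
  -- interior of its cylinder, hence beyond one of its two sides.
  have key : ∀ v w : List Bool, v ≠ w → v.length ≤ w.length →
      holeRight hγ t w - holeLeft hγ w ≤ C * t * |holeLeft hγ v - holeLeft hγ w| := by
    intro v w hne hl
    obtain ⟨h1, h2⟩ := h t ht ht2 w
    have hCt : 0 ≤ C * t := by positivity
    rcases wordMap_le_or_le hγ hl hne with h3 | h3
    · refine h1.trans (mul_le_mul_of_nonneg_left ?_ hCt)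
      rw [abs_sub_comm]
      exact le_trans (by linarith) (le_abs_self _)
    · exact h2.trans (mul_le_mul_of_nonneg_left (le_trans (by linarith) (le_abs_self _)) hCt)
  intro v w hne
  rcases le_total v.length w.length with hl | hl
  · exact (min_le_right _ _).trans (key v w hne hl)
  · rw [abs_sub_comm]
    exact (min_le_left _ _).trans (key w v hne.symm hl)

theorem exists_inverseBranch_map {x : ℝ} (hx : 0 ≤ x) :
    ∃ e, x = inverseBranch hγ e (map γ hγ x) := by
  unfold map
  split_ifs with h
  · refine ⟨false, ?_⟩
    simp [inverseBranch, ← lift_of_nonneg hx, liftInv_lift]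
  · refine ⟨true, ?_⟩
    simp [inverseBranch, ← lift_of_nonneg hx, liftInv_lift]

theorem exists_wordMap_iterate (n : ℕ) : ∀ {x : ℝ}, x ∈ Icc (0 : ℝ) 1 →
    ∃ w, x = wordMap hγ w ((map γ hγ)^[n] x) := by
  induction n with
  | zero => exact fun _ => ⟨[], rfl⟩
  | succ n ih =>
    intro x hx
    obtain ⟨e, he⟩ := exists_inverseBranch_map hγ hx.1
    obtain ⟨w, hw⟩ := ih (mapsTo_map γ hγ hx)
    refine ⟨e :: w, ?_⟩
    rw [Function.iterate_succ_apply]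
    change x = inverseBranch hγ e (wordMap hγ w _)
    rw [← hw]
    exact he

/-- A point which lies outside `[0, t)` and outside all the holes is exceptional. -/
theorem mem_exceptionalSet {t x : ℝ} (ht : 0 < t) (ht1 : t ≤ 1) (hx : x ∈ Icc (0 : ℝ) 1)
    (htx : t ≤ x) (h : ∀ w, x ∉ Icc (holeLeft hγ w) (holeRight hγ t w)) :
    x ∈ exceptionalSet γ hγ := by
  have hmem : ∀ n, (map γ hγ)^[n] x ∈ Icc (0 : ℝ) 1 := fun n => (mapsTo_map γ hγ).iterate n hx
  have key : ∀ n, t ≤ (map γ hγ)^[n] x := by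
    intro n
    induction n with
    | zero => exact htx
    | succ n ih =>
      by_contra! hlt
      obtain ⟨w, hw⟩ := exists_wordMap_iterate hγ n hx
      have hy := hmem n
      have hy' := hmem (n + 1)
      rw [Function.iterate_succ_apply'] at hlt hy'
      set y := (map γ hγ)^[n] x with hydef
      -- The left branch does not decrease points, so it cannot bring `y ≥ t` below `t`.
      have hyb : branchPoint γ hγ ≤ y := by
        by_contra! hyb
        rw [map, if_pos hyb] at hlt
        linarith [Real.rpow_nonneg hy.1 (1 + γ)]
      have hmy : y = liftInv γ hγ (1 + map γ hγ y) := by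
        rw [map, if_neg (not_lt.2 hyb), ← lift_of_nonneg hy.1, add_sub_cancel, liftInv_lift]
      have hm := (isContractingBranch_wordMap hγ w).strictMonoOn.monotoneOn
      refine h w ⟨?_, ?_⟩
      · rw [hw]
        refine hm (liftInv_mem_Icc hγ zero_le_one one_le_two) hy ?_
        rw [hmy]
        exact (liftInv γ hγ).monotone (by linarith [hy'.1])
      · rw [hw]
        refine hm hy (liftInv_mem_Icc hγ (by linarith) (by linarith)) ?_
        rw [hmy]
        exact (liftInv γ hγ).monotone (by linarith)
  refine ⟨hx, t, ht, ?_⟩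
  rw [eq_empty_iff_forall_notMem]
  rintro _ ⟨h1, n, rfl⟩
  exact absurd h1.2 (not_lt.2 (key n))

end

end MannevillePomeau

/-! ### Avoiding separated obstacles in one move -/

namespace SchmidtGame

open Set

namespace ClosedInterval

theorem length_pos (I : ClosedInterval) : 0 < I.length := sub_pos.2 I.left_lt_right

theorem length_le_of_subset {I J : ClosedInterval} (h : I.toSet ⊆ J.toSet) :
    I.length ≤ J.length := by
  have := (Icc_subset_Icc_iff I.left_lt_right.le).1 h
  unfold length
  linarith [this.1, this.2]

/-- The left quarter of an interval. -/
noncomputable def leftQuarter (I : ClosedInterval) : ClosedInterval where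
  left := I.left
  right := I.left + I.length / 4
  zero_le_left := I.zero_le_left
  left_lt_right := by linarith [I.length_pos]
  right_le_one := by
    have := I.right_le_one
    have := I.left_lt_right
    unfold length
    linarith

/-- The right quarter of an interval. -/
noncomputable def rightQuarter (I : ClosedInterval) : ClosedInterval where
  left := I.right - I.length / 4
  right := I.right
  zero_le_left := by
    have := I.zero_le_left
    have := I.left_lt_right
    unfold length
    linarith
  left_lt_right := by linarith [I.length_pos]
  right_le_one := I.right_le_one

theorem leftQuarter_length (I : ClosedInterval) : I.leftQuarter.length = I.length / 4 := by
  rw [length, leftQuarter]; ring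

theorem rightQuarter_length (I : ClosedInterval) : I.rightQuarter.length = I.length / 4 := by
  rw [length, rightQuarter]; ring

theorem leftQuarter_subset (I : ClosedInterval) : I.leftQuarter.toSet ⊆ I.toSet := by
  refine Icc_subset_Icc le_rfl ?_
  have := I.left_lt_right
  simp only [leftQuarter, length]
  linarith

theorem rightQuarter_subset (I : ClosedInterval) : I.rightQuarter.toSet ⊆ I.toSet := by
  refine Icc_subset_Icc ?_ le_rfl
  have := I.left_lt_right
  simp only [rightQuarter, length]
  linarith

end ClosedInterval

open Classical in
/-- Alice's reply to `B` when she has to avoid the intervals `[p i, q i]` longer than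
`δ * |B|`. -/
noncomputable def avoidReply {ι : Type*} (p q : ι → ℝ) (δ : ℝ) (B : ClosedInterval) :
    ClosedInterval :=
  if ∀ i, δ * B.length < q i - p i → Disjoint B.rightQuarter.toSet (Icc (p i) (q i))
  then B.rightQuarter else B.leftQuarter

section

variable {ι : Type*} (p q : ι → ℝ) (δ : ℝ) (B : ClosedInterval)

theorem avoidReply_length : (avoidReply p q δ B).length = B.length / 4 := by
  unfold avoidReply
  split_ifs
  exacts [B.rightQuarter_length, B.leftQuarter_length]

theorem avoidReply_subset : (avoidReply p q δ B).toSet ⊆ B.toSet := by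
  unfold avoidReply
  split_ifs
  exacts [B.rightQuarter_subset, B.leftQuarter_subset]

variable {p q δ B}

/-- If the obstacles longer than `δ * |B|` are well separated and those meeting `B` are not too
long, then Alice's reply avoids all of them. -/
theorem disjoint_avoidReply
    (hsep : ∀ i j, i ≠ j → δ * B.length < q i - p i → δ * B.length < q j - p j →
      2 * B.length < |p i - p j|)
    (hB : ∀ i, B.length / 4 < q i - p i → Disjoint B.toSet (Icc (p i) (q i)))
    {i : ι} (hi : δ * B.length < q i - p i) :
    Disjoint (avoidReply p q δ B).toSet (Icc (p i) (q i)) := by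
  unfold avoidReply
  split_ifs with h
  · exact h i hi
  by_contra hd
  push Not at h
  obtain ⟨j, hj, hd'⟩ := h
  obtain ⟨x, hx, hxi⟩ := not_disjoint_iff.1 hd
  obtain ⟨y, hy, hyj⟩ := not_disjoint_iff.1 hd'
  have bi : q i - p i ≤ B.length / 4 := by
    by_contra! hc
    exact disjoint_left.1 (hB i hc) (B.leftQuarter_subset hx) hxi
  have bj : q j - p j ≤ B.length / 4 := by
    by_contra! hc
    exact disjoint_left.1 (hB j hc) (B.rightQuarter_subset hy) hyj
  have hL := B.length_pos
  have e : B.length = B.right - B.left := rfl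
  obtain ⟨x1, x2⟩ := hx
  obtain ⟨y1, y2⟩ := hy
  simp only [ClosedInterval.leftQuarter] at x1 x2
  simp only [ClosedInterval.rightQuarter] at y1 y2
  obtain ⟨a1, a2⟩ := hxi
  obtain ⟨b1, b2⟩ := hyj
  -- One obstacle of length at most `|B| / 4` cannot bridge the gap `|B| / 2` between the outer
  -- quarters. Two different ones meeting `B` would have left ends within `2 * |B|` of each other.
  by_cases hij : i = j
  · subst hij
    linarith
  · refine absurd (hsep i j hij hi hj) (not_lt.2 (abs_le.2 ⟨?_, ?_⟩)) <;> linarith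

end

theorem nonempty_iInter_play {σ : Strategy} {B : ℕ → ClosedInterval}
    (h : ∀ n, (σ.play B (n + 1)).toSet ⊆ (σ.play B n).toSet) :
    (⋂ n, (σ.play B n).toSet).Nonempty :=
  IsCompact.nonempty_iInter_of_sequence_nonempty_isCompact_isClosed _ h
    (fun n => nonempty_Icc.2 (σ.play B n).left_lt_right.le) isCompact_Icc fun _ => isClosed_Icc

end SchmidtGame

/-! ### The winning strategy -/

open MannevillePomeau SchmidtGame Set in
theorem MannevillePomeau.isStrongWinningPair (γ : ℝ) (hγ : 0 < γ) {β : ℝ} (hβ : β ∈ Ioo (0 : ℝ) 1) :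
    IsStrongWinningPair (1 / 4) β (exceptionalSet γ hγ) := by
  obtain ⟨C, hC, hsep⟩ := exists_hole_separation hγ
  obtain ⟨hβ0, hβ1⟩ := hβ
  -- holes longer than `δ |B|` are avoided by the reply to `B`
  set δ := β / 16 with hδ
  have hδ0 : 0 < δ := by positivity
  -- The first bound makes holes longer than `δ * |B|` separated on the scale of `B`; the second
  -- leaves no such hole at Bob's first interval.
  set κ := min (δ / (4 * C)) δ with hκ
  have hκ0 : 0 < κ := lt_min (by positivity) hδ0
  have hκδ : κ ≤ δ := min_le_right _ _
  have hκC : C * κ ≤ δ / 4 := by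
    have := mul_le_mul_of_nonneg_left (min_le_left (δ / (4 * C)) δ) hC.le
    calc C * κ ≤ C * (δ / (4 * C)) := this
      _ = δ / 4 := by field_simp
  let σ : Strategy := fun n D =>
    avoidReply (holeLeft hγ) (holeRight hγ (κ * (D 0).length)) δ (D (Fin.last n))
  refine ⟨σ, fun B => ?_⟩
  set t := κ * (B 0).length with htdef
  have hplay : ∀ n, σ.play B n = avoidReply (holeLeft hγ) (holeRight hγ t) δ (B n) := by
    intro n
    simp [Strategy.play, σ, t]
  have hB0 : (B 0).length ≤ 1 := by
    have := (B 0).zero_le_left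
    have := (B 0).right_le_one
    unfold ClosedInterval.length
    linarith
  have hB0' := (B 0).length_pos
  have ht : 0 < t := mul_pos hκ0 hB0'
  have htκ : t ≤ κ := mul_le_of_le_one_right hκ0.le hB0
  have ht2 : t ≤ 1 / 2 := by linarith
  have hAB : ∀ n, (σ.play B n).toSet ⊆ (B n).toSet := fun n => by
    rw [hplay]; exact avoidReply_subset ..
  have hAl : ∀ n, (σ.play B n).length = (B n).length / 4 := fun n => by
    rw [hplay]; exact avoidReply_length ..
  refine ⟨fun n _ => ⟨hAB n, by rw [hAl]; linarith⟩, fun hBob => ?_⟩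
  have hsmall : ∀ w, holeRight hγ t w - holeLeft hγ w ≤ δ * (B 0).length := fun w =>
    (holeRight_sub_holeLeft_le hγ ht (by linarith) w).trans
      (mul_le_mul_of_nonneg_right hκδ hB0'.le)
  have hsep' : ∀ n v w, v ≠ w → δ * (B n).length < holeRight hγ t v - holeLeft hγ v →
      δ * (B n).length < holeRight hγ t w - holeLeft hγ w →
      2 * (B n).length < |holeLeft hγ v - holeLeft hγ w| := by
    intro n v w hne hv hw
    have h1 := (lt_min hv hw).trans_le (hsep t ht ht2 v w hne)
    have h2 : C * t ≤ δ / 4 := (mul_le_mul_of_nonneg_left htκ hC.le).trans hκC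
    have h3 := h1.trans_le (mul_le_mul_of_nonneg_right h2 (abs_nonneg _))
    have h4 : (B n).length < |holeLeft hγ v - holeLeft hγ w| / 4 := by
      refine lt_of_mul_lt_mul_left ?_ hδ0.le
      linarith
    linarith [(B n).length_pos]
  -- A hole longer than `|B (n + 1)| / 4` is longer than `β / 16 * |B n| = δ * |B n|`, because
  -- Alice's reply has length `|B n| / 4`; so that reply has already avoided it.
  have hinv : ∀ n w, (B n).length / 4 < holeRight hγ t w - holeLeft hγ w →
      Disjoint (B n).toSet (Icc (holeLeft hγ w) (holeRight hγ t w)) := by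
    intro n
    induction n with
    | zero =>
      intro w hw
      have := hsmall w
      nlinarith
    | succ n ih =>
      intro w hw
      obtain ⟨hs, hl⟩ := hBob n
      refine Disjoint.mono_left hs ?_
      rw [hplay]
      refine disjoint_avoidReply (hsep' n) ih ?_
      rw [hAl] at hl
      rw [hδ]
      linarith
  have hnest : ∀ n, (σ.play B (n + 1)).toSet ⊆ (σ.play B n).toSet := fun n =>
    (hAB (n + 1)).trans (hBob n).1
  obtain ⟨x, hx⟩ := nonempty_iInter_play hnest
  refine ⟨x, hx, ?_⟩
  rw [mem_iInter] at hx
  -- In the initial round no hole is long enough to count, so the default reply is the right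
  -- quarter, which keeps `x` above `t`.
  have hx0 : x ∈ (B 0).rightQuarter.toSet := by
    have h := hx 0
    rwa [hplay, avoidReply, if_pos fun w hw => absurd hw (not_lt.2 (hsmall w))] at h
  have hlen : ∀ n, (B n).length ≤ (1 / 4) ^ n := by
    intro n
    induction n with
    | zero => simpa using hB0
    | succ n ih =>
      have := ClosedInterval.length_le_of_subset (hBob n).1
      rw [hAl] at this
      rw [pow_succ]
      linarith
  refine mem_exceptionalSet hγ ht (by linarith) ?_ ?_ ?_
  · have := (B 0).rightQuarter.zero_le_left
    have := (B 0).rightQuarter.right_le_one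
    exact ⟨by linarith [hx0.1], by linarith [hx0.2]⟩
  · have h1 : (B 0).right - (B 0).length / 4 ≤ x := hx0.1
    have h2 : (B 0).length = (B 0).right - (B 0).left := rfl
    have h3 := (B 0).zero_le_left
    have h4 : t ≤ 1 / 16 * (B 0).length :=
      mul_le_mul_of_nonneg_right (by linarith) hB0'.le
    linarith
  · intro w hw
    have hpos := sub_pos.2 (holeLeft_lt_holeRight hγ ht (by linarith) w)
    -- Bob's intervals shrink to zero length, so each hole eventually exceeds the threshold and is
    -- avoided.
    obtain ⟨n, hn⟩ := exists_pow_lt_of_lt_one (div_pos hpos hδ0) (by norm_num : (1 / 4 : ℝ) < 1)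
    have hd : δ * (B n).length < holeRight hγ t w - holeLeft hγ w := by
      rw [lt_div_iff₀ hδ0] at hn
      nlinarith [hlen n]
    have := disjoint_avoidReply (hsep' n) (hinv n) hd
    rw [← hplay] at this
    exact disjoint_left.1 this (hx n) hw

theorem theorem1 (γ : ℝ) (hγ : 0 < γ) :
    SchmidtGame.IsStrongWinning (MannevillePomeau.exceptionalSet γ hγ) :=
  ⟨1 / 4, ⟨by norm_num, by norm_num⟩, fun _ hβ => MannevillePomeau.isStrongWinningPair γ hγ hβ⟩
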